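/- **Conventions.** Let $X$ be a finite set and let $W=\mathrm{Aut}(X^*)$ be the automorphism group of the rooted tree with vertex set $X^*$ and an edge from $v$ to $vx$ for all $v\in X^*$, $x\in X$. Every $g\in W$ is determined by a permutation $\pi\in\mathrm{Sym}(X)$ and states $g@x\in W$ with $(xv)^g=x^\pi v^{g@x}$ for $x\in X$, $v\in X^*$; this gives an isomorphism $\phi\colon W\to W^X\rtimes \mathrm{Sym}(X)$. A subgroup $G\le W$ is *self-similar* if all states of its elements lie in $G$. A *branching subgroup* of $G$ is a non-trivial subgroup $K\le G$ with $\phi(K)\ge K^X$ (i.e. for all $(k_x)_{x\in X}\in K^X$, the element acting on each subtree $xX^*$ as $k_x$ and fixing $X$ pointwise lies in $K$). A self-similar group is *weakly branched* if it has a branching subgroup. Let $H$ be a finitely generated group, $S$ a finite set with a surjective homomorphism from the free group on $S$ onto $H$, and $\Sigma=S\cup S^{-1}\cup\{1\}$ the corresponding standard generating set ($1$ is a padding letter). For words $u,w\in\Sigma^*$ put $[u,w]=u^{-1}w^{-1}uw$. The group $H$ is *uniformly SENS* (uniformly strongly efficiently non-solvable) if, for every such $\Sigma$, there are a constant $\mu\in\mathbb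 N$ and words $g_{d,v}\in\Sigma^*$ for $d\in\mathbb N$ and $v\in\{0,1\}^{\le d}$ such that - (a) $|g_{d,v}|=2^{\mu d}$ for all $v\in\{0,1\}^d$; - (b) $g_{d,v}=[g_{d,v0},g_{d,v1}]$ for all $v\in\{0,1\}^{<d}$; - (c) $g_{d,\varepsilon}\ne 1$ in $H$; - (d) given $v\in\{0,1\}^d$, a number $i$ encoded in binary with $\mu d$ bits, and $a\in\Sigma$, one can decide in linear time on a deterministic (multitape, random access) Turing machine, the same one for all $d$, whether the $i$-th letter of $g_{d,v}$ is $a$. **Theorem.** Let $G\le \mathrm{Aut}(X^*)$ be a weakly branched self-similar group, and let $K$ be a finitely generated branching subgroup of $G$. Then $K$ is uniformly SENS. Consequently, if $G$ is finitely generated, then $G$ is uniformly SENS as well. -/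

import Mathlib

/-! ### Automorphisms of the rooted tree of words, weakly branched groups -/

/-- The edges of the rooted tree with vertex set `X^*` (`List X`), directed away from the root:
`v` is joined to `v x` for every letter `x`. -/
def TreeEdge {X : Type*} (u v : List X) : Prop := ∃ x : X, v = u ++ [x]

/-- The automorphism group of the rooted tree of words over `X`. -/
def treeAut (X : Type*) : Subgroup (Equiv.Perm (List X)) where
  carrier := {g | ∀ u v, TreeEdge (g u) (g v) ↔ TreeEdge u v}
  one_mem' := fun _ _ => Iff.rfl
  mul_mem' := fun {a b} ha hb u v => (ha (b u) (b v)).trans (hb u v)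
  inv_mem' := fun {a} ha u v => by
    have h := ha (a.symm u) (a.symm v)
    rw [Equiv.apply_symm_apply, Equiv.apply_symm_apply] at h
    exact h.symm

/-- `IsWreathDecomposition g f π` says that the image of `g` under the canonical isomorphism
`Aut(X^*) ≅ Aut(X^*)^X ⋊ Sym X` is the pair of `f` and `π`: the image of `x v` under `g` is
`π(x)` followed by the image of `v` under the state `f x`. -/
def IsWreathDecomposition {X : Type*} (g : treeAut X) (f : X → treeAut X)
    (π : Equiv.Perm X) : Prop :=
  ∀ (x : X) (v : List X), g.1 (x :: v) = π x :: (f x).1 v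

/-- `G` is self-similar: `φ(G) ≤ G ≀ Sym X`. -/
def IsSelfSimilar {X : Type*} (G : Subgroup (treeAut X)) : Prop :=
  ∀ g ∈ G, ∃ (f : X → treeAut X) (π : Equiv.Perm X),
    (∀ x, f x ∈ G) ∧ IsWreathDecomposition g f π

/-- `K` is a branching subgroup of `G`: a non-trivial subgroup of `G` with `φ(K) ≥ K^X`. -/
def IsBranchingSubgroup {X : Type*} (K G : Subgroup (treeAut X)) : Prop :=
  K ≤ G ∧ K ≠ ⊥ ∧
    ∀ f : X → treeAut X, (∀ x, f x ∈ K) → ∃ k ∈ K, IsWreathDecomposition k f 1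

/-- Weakly branched self-similar groups of automorphisms of the tree `X^*`. -/
def IsWeaklyBranched {X : Type*} (G : Subgroup (treeAut X)) : Prop :=
  IsSelfSimilar G ∧ ∃ K : Subgroup (treeAut X), IsBranchingSubgroup K G

/-! ### Deterministic Turing machines with random access to the input -/

/-- What a machine with `k` work tapes over the alphabet `A` (plus blank, `none`) does in one step.
A move `-1`, `0`, `1` is a move to the left, no move, a move to the right. -/
structure DTMAction (Q A : Type) (k : ℕ) where
  state : Q
  inputMove : SignType
  indexWrite : Option Bool
  indexMove : SignType
  workWrite : Fin k → Option A
  workMove : Fin k → SignType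

/-- A deterministic multitape Turing machine with input alphabet `Γ`: a read-only input tape,
an index tape (cells `0`, `1` or blank) and `tapes` work tapes.  The transition function receives
the state, the input symbol under the input head, the queried input symbol (blank unless the state
is a query state), the symbol under the index head and the symbols under the work heads. -/
structure DTM (Γ : Type*) where
  State : Type
  finite_state : Finite State
  Sym : Type
  finite_sym : Finite Sym
  tapes : ℕ
  start : State
  isQuery : State → Bool
  /-- `some true`: halt and accept, `some false`: halt and reject, `none`: continue. -/
  verdict : State → Option Bool
  next : State → Option Γ → Option Γ → Option Bool → (Fin tapes → Option Sym) →
    DTMAction State Sym tapes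

namespace DTM

variable {Γ : Type*}

/-- Configurations: state, head positions and contents of the two-way infinite tapes. -/
structure Cfg (M : DTM Γ) where
  state : M.State
  inputHead : ℤ
  indexHead : ℤ
  indexTape : ℤ → Option Bool
  workHead : Fin M.tapes → ℤ
  workTape : Fin M.tapes → ℤ → Option M.Sym

/-- The initial configuration: all heads at cell `0`, index and work tapes blank. -/
def init (M : DTM Γ) : M.Cfg where
  state := M.start
  inputHead := 0
  indexHead := 0
  indexTape := fun _ => none
  workHead := fun _ => 0
  workTape := fun _ _ => none

/-- The content of cell `z` of the input tape, on input `w` (written in the cells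
`0, …, |w| - 1`). -/
def inputCell (w : List Γ) (z : ℤ) : Option Γ :=
  if 0 ≤ z then w[z.toNat]? else none

/-- The number written in binary on the index tape: least significant bit in cell `0`, blank cells
count as `0`. -/
noncomputable def indexValue (T : ℤ → Option Bool) : ℕ :=
  ∑ᶠ j : ℕ, if T (j : ℤ) = some true then 2 ^ j else 0

/-- What the transition function prescribes in configuration `c` on input `w`. -/
noncomputable def action (M : DTM Γ) (w : List Γ) (c : M.Cfg) :
    DTMAction M.State M.Sym M.tapes :=
  M.next c.state (inputCell w c.inputHead)
    (if M.isQuery c.state = true then w[indexValue c.indexTape]? else none)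
    (c.indexTape c.indexHead) (fun t => c.workTape t (c.workHead t))

/-- One step on input `w`; a halted configuration does not change. -/
noncomputable def step (M : DTM Γ) (w : List Γ) (c : M.Cfg) : M.Cfg :=
  if (M.verdict c.state).isSome = true then c
  else
    { state := (M.action w c).state
      inputHead := c.inputHead + ((M.action w c).inputMove : ℤ)
      indexHead := c.indexHead + ((M.action w c).indexMove : ℤ)
      indexTape := Function.update c.indexTape c.indexHead (M.action w c).indexWrite
      workHead := fun t => c.workHead t + ((M.action w c).workMove t : ℤ)
      workTape := fun t =>
        Function.update (c.workTape t) (c.workHead t) ((M.action w c).workWrite t) }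

/-- On every input `w`, the machine halts after at most `T |w|` steps, and it accepts `w` if and
only if `w` belongs to `L`. -/
def DecidesInTime (M : DTM Γ) (L : Set (List Γ)) (T : ℕ → ℕ) : Prop :=
  ∀ w : List Γ, ∃ b : Bool,
    M.verdict ((M.step w)^[T w.length] M.init).state = some b ∧ (b = true ↔ w ∈ L)

end DTM

/-- The language `L` over the finite alphabet `Γ` is in `DLINTIME`. -/
def InDLINTIME {Γ : Type*} [Finite Γ] (L : Set (List Γ)) : Prop :=
  ∃ (M : DTM Γ) (C : ℕ), M.DecidesInTime L (fun n => C * n + C)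

/-! ### Words over a standard generating set -/

/-- The standard alphabet `Σ = S ∪ S⁻¹ ∪ {1}`: `some (s, true)` is the letter `s`,
`some (s, false)` is the letter `s⁻¹`, and `none` is the padding letter `1`. -/
abbrev StdLetter (S : Type) : Type := Option (S × Bool)

/-- The inverse letter. -/
def StdLetter.inv {S : Type} (a : StdLetter S) : StdLetter S :=
  a.map fun p => (p.1, !p.2)

/-- The formal inverse `(a₁ ⋯ aₙ)⁻¹ = aₙ⁻¹ ⋯ a₁⁻¹` of a word. -/
def wordInv {S : Type} (w : List (StdLetter S)) : List (StdLetter S) :=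
  (w.map StdLetter.inv).reverse

/-- The commutator `[u, v] = u⁻¹ v⁻¹ u v` of words. -/
def wordComm {S : Type} (u v : List (StdLetter S)) : List (StdLetter S) :=
  wordInv u ++ wordInv v ++ u ++ v

/-- The element of the group represented by a letter. -/
def letterEval {S : Type} {G : Type*} [Group G] (φ : FreeGroup S →* G) (a : StdLetter S) : G :=
  a.elim 1 fun p => if p.2 = true then φ (FreeGroup.of p.1) else (φ (FreeGroup.of p.1))⁻¹

/-- The element of the group represented by a word. -/
def wordEval {S : Type} {G : Type*} [Group G] (φ : FreeGroup S →* G)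
    (w : List (StdLetter S)) : G :=
  (w.map (letterEval φ)).prod

/-! ### Uniformly strongly efficiently non-solvable groups -/

/-- The words `g d v` (only those with `|v| ≤ d` matter) witness, with the constant `μ`, that the
group is strongly efficiently non-solvable. -/
structure IsSENSWitness {S : Type} {G : Type*} [Group G] (φ : FreeGroup S →* G) (μ : ℕ)
    (g : ℕ → List Bool → List (StdLetter S)) : Prop where
  length_eq : ∀ (d : ℕ) (v : List Bool), v.length = d → (g d v).length = 2 ^ (μ * d)
  comm_eq : ∀ (d : ℕ) (v : List Bool), v.length < d →
    g d v = wordComm (g d (v ++ [false])) (g d (v ++ [true]))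
  eval_ne : ∀ d : ℕ, wordEval φ (g d []) ≠ 1

/-- The binary representation of `i` with `m` bits, most significant bit first. -/
def binaryBits (m i : ℕ) : List Bool := List.ofFn fun j : Fin m => i.testBit (m - 1 - j)

/-- The alphabet used to write down triples `(v, i, a)`: bits, a separator and the letters. -/
abbrev QuerySym (S : Type) : Type := Option Bool ⊕ StdLetter S

/-- The triple of the bit strings `v` and `u` and of the letter `a`, as the word `v # u # a`. -/
def encodeQuery {S : Type} (v u : List Bool) (a : StdLetter S) : List (QuerySym S) :=
  v.map (fun b => Sum.inl (some b)) ++ [Sum.inl none] ++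
    u.map (fun b => Sum.inl (some b)) ++ [Sum.inl none] ++ [Sum.inr a]

/-- The language of all triples `(v, i, a)` with `i` written with `μ |v|` bits, such that the
letter of `g |v| v` at position `i` (counted from `0`) is `a`. -/
def letterLanguage {S : Type} (μ : ℕ) (g : ℕ → List Bool → List (StdLetter S)) :
    Set (List (QuerySym S)) :=
  {w | ∃ (v : List Bool) (i : ℕ) (a : StdLetter S), i < 2 ^ (μ * v.length) ∧
    (g v.length v)[i]? = some a ∧ w = encodeQuery v (binaryBits (μ * v.length) i) a}

/-- Uniform strong efficient non-solvability with respect to the standard generating set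
`S ∪ S⁻¹ ∪ {1}` given by `φ : FreeGroup S →* G`. -/
def IsUniformlySENSOver {S : Type} [Finite S] {G : Type*} [Group G]
    (φ : FreeGroup S →* G) : Prop :=
  ∃ (μ : ℕ) (g : ℕ → List Bool → List (StdLetter S)),
    IsSENSWitness φ μ g ∧ InDLINTIME (letterLanguage μ g)

/-- `G` is a finitely generated group that is uniformly strongly efficiently non-solvable, with
respect to each of its finite standard generating sets. -/
def IsUniformlySENS (G : Type*) [Group G] : Prop :=
  Group.FG G ∧ ∀ (S : Type) [Finite S] (φ : FreeGroup S →* G),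
    Function.Surjective φ → IsUniformlySENSOver φ

/-! ### Automorphisms of the tree -/

section Tree

variable {X : Type*}

/-! Choose `k` in `K` and a vertex `u` with `k u ≠ u`, and let `ψ : K →* K` place automorphisms at
`u`; such a `ψ` exists because `K` contains `K^X`, by induction along `u`. As `k` carries the
subtree at `u` off itself, the commutator of `k` and `ψ h` acts as `h` below `u`
(`IsPlacement.commutator_apply`). Give a leaf `v` the value `ψ^t k`, where `t` is the number of
letters `1` at the end of `v`. By induction up the binary tree, the node `v` at height `n` acts
below the vertex `u^n` as `ψ^t k`, with `t` read off from `v` in the same way: its children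
contribute `k` and `ψ (ψ^t k)` (`exists_commTree_actsBelow`). Hence for `d > 0` the root acts as `k`
below `u^d` and is non-trivial.

The leaves must be words of length exactly `2^(μ d)` with quickly computable letters. Since `K` is
finitely generated, `ψ` is described by a substitution of constant length `2^μ` on finitely many
symbols. Reading `v` backwards, each `1` rewrites the generators as words for their images under
`ψ`, the first `0` spells them in the letters of `S`, and after that only padding is added
(`exists_isSpelling`, `IsSpelling.wordEval_live`).

Each block of `μ` bits of a position then selects one symbol out of the `2^μ` symbols produced by
one substitution (`descend_eq`). A machine that keeps `v` on a stack and a list of bounded length in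
its state performs this bisection while reading the input once, without random access
(`scanMachine_decidesInTime`). -/

theorem treeAut_apply_nil (g : treeAut X) : g.1 [] = [] := by
  rcases List.eq_nil_or_concat (g.1 []) with h | ⟨v, y, h⟩
  · exact h
  -- An edge into `g []` would pull back to an edge into the root, and there is none.
  · obtain ⟨x, hx⟩ := (g.2 (g.1.symm v) []).1 ⟨y, by simpa using h⟩
    simp at hx

theorem treeAut_apply_append (g : treeAut X) (u w : List X) :
    ∃ w' : List X, w'.length = w.length ∧ g.1 (u ++ w) = g.1 u ++ w' := by
  induction w using List.reverseRecOn with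
  | nil => exact ⟨[], rfl, by simp⟩
  | append_singleton w x ih =>
    obtain ⟨w', hl, h⟩ := ih
    obtain ⟨y, hy⟩ := (g.2 (u ++ w) (u ++ w ++ [x])).2 ⟨x, rfl⟩
    exact ⟨w' ++ [y], by simp [hl], by rw [← List.append_assoc, hy, h, List.append_assoc]⟩

theorem treeAut_length_apply (g : treeAut X) (u : List X) : (g.1 u).length = u.length := by
  obtain ⟨w, hl, h⟩ := treeAut_apply_append g [] u
  rw [List.nil_append, treeAut_apply_nil, List.nil_append] at h
  rw [h, hl]

/-- `IsPlacement u ψ`: for each `h`, the automorphism `ψ h` acts as `h` on the subtree below the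
vertex `u`, and trivially elsewhere. -/
def IsPlacement {K : Subgroup (treeAut X)} (u : List X) (ψ : K →* K) : Prop :=
  ∀ (h : K) (w : List X), (ψ h).1.1 (u ++ w) = u ++ h.1.1 w ∧
    ∀ z : List X, z.length = u.length → z ≠ u → (ψ h).1.1 (z ++ w) = z ++ w

theorem exists_isPlacement_singleton {K G : Subgroup (treeAut X)} (hK : IsBranchingSubgroup K G)
    (x : X) : ∃ ψ : K →* K, IsPlacement [x] ψ := by
  classical
  have key : ∀ h : K, ∃ k : K, IsWreathDecomposition k.1 (Pi.mulSingle x h.1) 1 := fun h => by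
    obtain ⟨k, hk, hd⟩ := hK.2.2 (Pi.mulSingle x h.1) (fun y => by
      by_cases hy : y = x
      · subst hy; simp [h.2]
      · simp [hy, K.one_mem])
    exact ⟨⟨k, hk⟩, hd⟩
  choose f hf using key
  have hx : ∀ h w, (f h).1.1 (x :: w) = x :: h.1.1 w := fun h w => by
    have := hf h x w
    simpa using this
  have hy : ∀ h y w, y ≠ x → (f h).1.1 (y :: w) = y :: w := fun h y w hne => by
    have := hf h y w
    simpa [hne] using this
  -- The choice `f` is multiplicative because a wreath decomposition determines the automorphism.
  refine ⟨MonoidHom.mk' f fun a b => ?_, fun h w => ⟨hx h w, fun z hz hne => ?_⟩⟩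
  · refine Subtype.ext (Subtype.ext (Equiv.ext fun v => ?_))
    change (f (a * b)).1.1 v = (f a).1.1 ((f b).1.1 v)
    cases v with
    | nil => simp only [treeAut_apply_nil]
    | cons y w =>
      by_cases h : y = x
      · subst h
        rw [hx, hx, hx]
        rfl
      · rw [hy _ _ _ h, hy _ _ _ h, hy _ _ _ h]
  · obtain ⟨y, rfl⟩ := List.length_eq_one_iff.1 hz
    exact hy h y w fun e => hne (by rw [e])

theorem exists_isPlacement {K G : Subgroup (treeAut X)} (hK : IsBranchingSubgroup K G)
    (u : List X) : ∃ ψ : K →* K, IsPlacement u ψ := by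
  induction u with
  | nil => exact ⟨MonoidHom.id K, fun h w => ⟨rfl, fun z hz hne =>
      absurd (List.length_eq_zero_iff.1 hz) hne⟩⟩
  | cons x u ih =>
    obtain ⟨ψ, hψ⟩ := ih
    obtain ⟨χ, hχ⟩ := exists_isPlacement_singleton hK x
    refine ⟨χ.comp ψ, fun h w => ⟨?_, fun z hz hne => ?_⟩⟩
    · have := (hχ (ψ h) (u ++ w)).1
      rw [(hψ h w).1] at this
      exact this
    · match z, hz with
      | y :: z, hz =>
        by_cases hyx : y = x
        · subst hyx
          have h1 := (hχ (ψ h) (z ++ w)).1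
          rw [(hψ h w).2 z (by simpa using hz) fun e => hne (by rw [e])] at h1
          exact h1
        · exact (hχ (ψ h) (z ++ w)).2 [y] rfl (by simpa using hyx)

/-- If `k` moves `u`, then the commutator of `k` and of `h` placed at `u` acts as `h` below `u`. -/
theorem IsPlacement.commutator_apply {K : Subgroup (treeAut X)} {u : List X} {ψ : K →* K}
    (hψ : IsPlacement u ψ) {k : K} (hk : k.1.1 u ≠ u) (h : K) (w : List X) :
    (k⁻¹ * (ψ h)⁻¹ * k * ψ h).1.1 (u ++ w) = u ++ h.1.1 w := by
  change k.1.1.symm ((ψ h).1.1.symm (k.1.1 ((ψ h).1.1 (u ++ w)))) = _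
  rw [(hψ h w).1]
  obtain ⟨w', -, hw'⟩ := treeAut_apply_append k.1 u (h.1.1 w)
  -- `k` moves the subtree at `u` to a different subtree of the same level, where `ψ h` is trivial.
  have hfix : (ψ h).1.1.symm (k.1.1 (u ++ h.1.1 w)) = k.1.1 (u ++ h.1.1 w) := by
    rw [Equiv.symm_apply_eq, hw', (hψ h w').2 _ (treeAut_length_apply _ _) hk]
  rw [hfix, Equiv.symm_apply_apply]

end Tree

/-! ### Words generated by substitutions -/

section Expansion

variable {Q : Type*}

/-- The word obtained from the symbol `q` by applying the substitutions `θ b`, for the letters `b`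
of `v` from left to right. -/
def expand (θ : Bool → Q → List Q) : List Bool → Q → List Q
  | [], q => [q]
  | b :: v, q => (θ b q).flatMap (expand θ v)

/-- The first or the second half of a list. -/
def halve (c : Bool) (l : List Q) : List Q :=
  if c = true then l.drop (l.length / 2) else l.take (l.length / 2)

/-- The entry of a list of length one. -/
def single? : List Q → Option Q
  | [q] => some q
  | _ => none

/-- Find a letter of `l.flatMap (expand θ st)` by bisection, with the bits of its position. -/
def descend (θ : Bool → Q → List Q) : List Bool → List Q → List Bool → Option Q
  | [], l, st => if st = [] then single? l else none
  | c :: u, l, st =>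
    match single? l, st with
    | some q, b :: st' => descend θ u (halve c (θ b q)) st'
    | some _, [] => none
    | none, st => descend θ u (halve c l) st

/-! ### Binary digits of a position -/

/-- The number with given binary digits, most significant first. -/
def bitsValue : List Bool → ℕ
  | [] => 0
  | c :: u => c.toNat * 2 ^ u.length + bitsValue u

theorem bitsValue_lt (u : List Bool) : bitsValue u < 2 ^ u.length := by
  induction u with
  | nil => simp [bitsValue]
  | cons c u ih =>
    cases c <;> simp only [bitsValue, Bool.toNat_false, Bool.toNat_true, List.length_cons,
      pow_succ] <;> omega

theorem testBit_bitsValue (u : List Bool) (j : ℕ) (hj : j < u.length) :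
    (bitsValue u).testBit (u.length - 1 - j) = u[j] := by
  induction u generalizing j with
  | nil => simp at hj
  | cons c u ih =>
    have hlt := bitsValue_lt u
    rw [bitsValue, mul_comm]
    cases j with
    | zero =>
      rw [Nat.testBit_two_pow_mul_add _ hlt]
      cases c <;> simp
    | succ j =>
      have hj' : j < u.length := by simpa using hj
      rw [Nat.testBit_two_pow_mul_add _ hlt, if_pos (by simp; omega)]
      rw [List.getElem_cons_succ, ← ih j hj']
      congr 1
      simp; omega

theorem binaryBits_bitsValue (u : List Bool) : binaryBits u.length (bitsValue u) = u := by
  apply List.ext_getElem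
  · simp [binaryBits]
  · intro j h1 h2
    simpa [binaryBits] using testBit_bitsValue u j h2

theorem length_binaryBits (m i : ℕ) : (binaryBits m i).length = m := by simp [binaryBits]

theorem bitsValue_binaryBits {m i : ℕ} (hi : i < 2 ^ m) : bitsValue (binaryBits m i) = i := by
  apply Nat.eq_of_testBit_eq
  intro j
  by_cases hj : j < m
  · have h := testBit_bitsValue (binaryBits m i) (m - 1 - j) (by rw [length_binaryBits]; omega)
    simp only [length_binaryBits, show m - 1 - (m - 1 - j) = j by omega] at h
    rw [h]
    simp only [binaryBits, List.getElem_ofFn]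
    congr 1
    omega
  · have hb := bitsValue_lt (binaryBits m i)
    rw [length_binaryBits] at hb
    have hp : 2 ^ m ≤ 2 ^ j := Nat.pow_le_pow_right (by norm_num) (by omega)
    rw [Nat.testBit_lt_two_pow (hb.trans_le hp), Nat.testBit_lt_two_pow (hi.trans_le hp)]

theorem single?_eq_some {l : List Q} {q : Q} : single? l = some q ↔ l = [q] := by
  unfold single?
  split
  · simp
  · rename_i h
    simpa using fun e => h q e

theorem single?_eq_none {l : List Q} (h : l.length ≠ 1) : single? l = none := by
  unfold single?
  split
  · simp at h
  · rfl

theorem length_halve {l : List Q} {n : ℕ} (h : l.length = 2 * n) (c : Bool) :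
    (halve c l).length = n := by
  unfold halve
  split <;> simp <;> omega

theorem length_halve_le (l : List Q) (c : Bool) : (halve c l).length ≤ l.length := by
  unfold halve
  split <;> simp

/-! ### Lengths of expansions and correctness of the bisection -/

variable {θ : Bool → Q → List Q} {μ : ℕ}

theorem length_flatMap_of_forall {β : Type*} (l : List Q) (f : Q → List β) (p : ℕ)
    (hf : ∀ q, (f q).length = p) : (l.flatMap f).length = l.length * p := by
  induction l with
  | nil => simp
  | cons q l ih => simp [ih, hf, Nat.succ_mul, add_comm]

theorem length_expand (hθ : ∀ b q, (θ b q).length = 2 ^ μ) (v : List Bool) (q : Q) :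
    (expand θ v q).length = 2 ^ (μ * v.length) := by
  induction v generalizing q with
  | nil => simp [expand]
  | cons b v ih =>
    rw [expand, length_flatMap_of_forall _ _ _ ih, hθ, List.length_cons, ← pow_add]
    ring_nf

/-- All symbols expand to the same length, so the midpoint of `l` corresponds to the midpoint of its
expansion, and the top bit of the position selects the half. -/
theorem getElem?_flatMap_halve {β : Type*} {l : List Q} {f : Q → List β} {n p N : ℕ}
    (hl : l.length = 2 * n) (hf : ∀ q, (f q).length = p) (hN : n * p = N) (c : Bool) {j : ℕ}
    (hj : j < N) :
    (l.flatMap f)[c.toNat * N + j]? = ((halve c l).flatMap f)[j]? := by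
  have h1 : l.flatMap f = (l.take n).flatMap f ++ (l.drop n).flatMap f := by
    rw [← List.flatMap_append, List.take_append_drop]
  have h2 : ((l.take n).flatMap f).length = N := by
    rw [length_flatMap_of_forall _ _ _ hf, ← hN, List.length_take]
    congr 1
    omega
  rw [h1, halve, hl, Nat.mul_div_cancel_left _ two_pos]
  cases c
  · rw [List.getElem?_append_left (by simp [h2, hj])]
    simp
  · rw [List.getElem?_append_right (by simp [h2])]
    simp [h2]

theorem descend_singleton_cons (c b : Bool) (u st : List Bool) (q : Q) :
    descend θ (c :: u) [q] (b :: st) = descend θ u (halve c (θ b q)) st := rfl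

theorem descend_cons_of_length_ne_one {l : List Q} (h : l.length ≠ 1) (c : Bool)
    (u st : List Bool) : descend θ (c :: u) l st = descend θ u (halve c l) st := by
  rw [descend]
  exact single?_eq_none h

/-- The hypothesis on `u` provides `m` bits to cut `l` down to one symbol and `μ` bits for each
pending substitution. -/
theorem descend_eq (hμ : 0 < μ) (hθ : ∀ b q, (θ b q).length = 2 ^ μ) (u : List Bool) (l : List Q)
    (st : List Bool) (m : ℕ) (hl : l.length = 2 ^ m) (hu : u.length = m + μ * st.length) :
    descend θ u l st = (l.flatMap (expand θ st))[bitsValue u]? := by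
  induction u generalizing l st m with
  | nil =>
    simp only [List.length_nil] at hu
    obtain rfl : m = 0 := by omega
    have hst : st = [] := by
      rcases Nat.mul_eq_zero.1 (by omega : μ * st.length = 0) with h | h
      · omega
      · exact List.length_eq_zero_iff.1 h
    obtain ⟨q, rfl⟩ := List.length_eq_one_iff.1 (by simpa using hl)
    simp [descend, hst, single?, expand, bitsValue]
  | cons c u ih =>
    rw [List.length_cons] at hu
    cases m with
    | zero =>
      obtain ⟨q, rfl⟩ := List.length_eq_one_iff.1 (by simpa using hl)
      cases st with
      | nil => simp at hu
      | cons b st =>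
        -- Substitution and first halving share one bit, so `μ - 1` bits remain for the new list.
        obtain ⟨ν, rfl⟩ : ∃ ν, μ = ν + 1 := ⟨μ - 1, by omega⟩
        have h2 : (θ b q).length = 2 * 2 ^ ν := by rw [hθ, pow_succ, mul_comm]
        have h3 : u.length = ν + (ν + 1) * st.length := by
          rw [List.length_cons, mul_add] at hu
          omega
        rw [descend_singleton_cons]
        simp only [bitsValue, List.flatMap_cons, List.flatMap_nil, List.append_nil]
        rw [ih _ st ν (length_halve h2 c) h3, expand, getElem?_flatMap_halve h2
          (length_expand hθ st) (by rw [h3, pow_add]) c (bitsValue_lt u)]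
    | succ m =>
      have h2 : l.length = 2 * 2 ^ m := by rw [hl, pow_succ, mul_comm]
      have h3 : u.length = m + μ * st.length := by omega
      rw [descend_cons_of_length_ne_one (by omega)]
      simp only [bitsValue]
      rw [ih _ st m (length_halve h2 c) h3, getElem?_flatMap_halve h2
          (length_expand hθ st) (by rw [h3, pow_add]) c (bitsValue_lt u)]

/-- The descent succeeds only if the bits run out together with the stack, so the machine need not
count the bits of the position. -/
theorem length_of_descend_eq_some (hμ : 0 < μ) (hθ : ∀ b q, (θ b q).length = 2 ^ μ)
    (u : List Bool) (l : List Q) (st : List Bool) (m : ℕ) (hl : l.length = 2 ^ m) {q : Q}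
    (h : descend θ u l st = some q) : u.length = m + μ * st.length := by
  induction u generalizing l st m with
  | nil =>
    rw [descend] at h
    split_ifs at h with hst
    subst hst
    rw [single?_eq_some.1 h] at hl
    cases m with
    | zero => simp
    | succ m =>
      simp only [List.length_cons, List.length_nil, pow_succ] at hl
      omega
  | cons c u ih =>
    cases m with
    | zero =>
      obtain ⟨p, rfl⟩ := List.length_eq_one_iff.1 (by simpa using hl)
      cases st with
      | nil => simp [descend, single?] at h
      | cons b st =>
        rw [descend_singleton_cons] at h
        obtain ⟨ν, rfl⟩ : ∃ ν, μ = ν + 1 := ⟨μ - 1, by omega⟩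
        have h2 : (θ b p).length = 2 * 2 ^ ν := by rw [hθ, pow_succ, mul_comm]
        have h3 := ih _ st ν (length_halve h2 c) h
        rw [List.length_cons, List.length_cons, mul_add]
        omega
    | succ m =>
      have h2 : l.length = 2 * 2 ^ m := by rw [hl, pow_succ, mul_comm]
      rw [descend_cons_of_length_ne_one (by omega)] at h
      have h3 := ih _ st m (length_halve h2 c) h
      rw [List.length_cons]
      omega

end Expansion

/-! ### A real-time machine that finds letters by bisection -/

/-- The states of the machine: `push` copies bits onto the work tape, `scan` performs the
bisection, `letter` compares with the last letter, `finish` looks for the end of the input. -/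
inductive ScanState (Q : Type) (N : ℕ) where
  | push : ScanState Q N
  | scan (l : {l : List Q // l.length ≤ N}) : ScanState Q N
  | letter (q : Q) : ScanState Q N
  | finish (ok : Bool) : ScanState Q N
  | halt (b : Bool) : ScanState Q N

section Machine

variable {Q : Type} {N : ℕ} {L : Type*}

instance [Finite Q] : Finite (ScanState Q N) := by
  have : Finite {l : List Q // l.length ≤ N} := (List.finite_length_le Q N).to_subtype
  let f : Unit ⊕ {l : List Q // l.length ≤ N} ⊕ Q ⊕ Bool ⊕ Bool → ScanState Q N :=
    Sum.elim (fun _ => .push) (Sum.elim .scan (Sum.elim .letter (Sum.elim .finish .halt)))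
  refine Finite.of_surjective f fun s => ?_
  cases s with
  | push => exact ⟨.inl (), rfl⟩
  | scan l => exact ⟨.inr (.inl l), rfl⟩
  | letter q => exact ⟨.inr (.inr (.inl q)), rfl⟩
  | finish b => exact ⟨.inr (.inr (.inr (.inl b))), rfl⟩
  | halt b => exact ⟨.inr (.inr (.inr (.inr b))), rfl⟩

/-- The prefix of length `N` of a list. -/
def truncate (N : ℕ) (l : List Q) : {l : List Q // l.length ≤ N} :=
  ⟨l.take N, by simp⟩

/-- Truncation serves only to keep the state set finite; on the lists that occur it changes nothing.
-/
theorem truncate_val {l : List Q} (h : l.length ≤ N) : (truncate N l).1 = l :=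
  List.take_of_length_le h

open Classical in
/-- The new state, the symbol written on the work tape and the move of the work head. -/
noncomputable def scanNext (θ : Bool → Q → List Q) (q₀ : Q) (out : Q → L) :
    ScanState Q N → Option (Option Bool ⊕ L) → Option Bool →
      ScanState Q N × Option Bool × SignType
  | .push, some (.inl (some b)), _ => (.push, some b, 1)
  | .push, some (.inl none), t => (.scan (truncate N [q₀]), t, -1)
  | .scan l, some (.inl (some c)), t =>
    match single? l.1, t with
    | some q, some b => (.scan (truncate N (halve c (θ b q))), some b, -1)
    | some _, none => (.halt false, none, 0)
    | none, t => (.scan (truncate N (halve c l.1)), t, 0)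
  | .scan l, some (.inl none), none =>
    match single? l.1 with
    | some q => (.letter q, none, 0)
    | none => (.halt false, none, 0)
  | .letter q, some (.inr a), t => (.finish (decide (out q = a)), t, 0)
  | .finish ok, none, t => (.halt ok, t, 0)
  | _, _, t => (.halt false, t, 0)

/-- The machine that finds letters of iterated substitutions by bisection. -/
noncomputable def scanMachine [Finite Q] (N : ℕ) (θ : Bool → Q → List Q) (q₀ : Q)
    (out : Q → L) : DTM (Option Bool ⊕ L) where
  State := ScanState Q N
  finite_state := inferInstance
  Sym := Bool
  finite_sym := inferInstance
  tapes := 1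
  start := .push
  isQuery := fun _ => false
  verdict := fun s => match s with
    | .halt b => some b
    | _ => none
  next := fun s x _ _ T =>
    { state := (scanNext θ q₀ out s x (T 0)).1
      inputMove := 1
      indexWrite := none
      indexMove := 0
      workWrite := fun _ => (scanNext θ q₀ out s x (T 0)).2.1
      workMove := fun _ => (scanNext θ q₀ out s x (T 0)).2.2 }

/-! ### Halting times and tape invariants -/

/-- Starting from `c`, the machine halts within `n` steps, and accepts if and only if `P`. -/
def DTM.HaltsIn {Γ : Type*} (M : DTM Γ) (w : List Γ) (c : M.Cfg) (n : ℕ) (P : Prop) : Prop :=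
  ∃ b : Bool, M.verdict ((M.step w)^[n] c).state = some b ∧ (b = true ↔ P)

theorem DTM.HaltsIn.of_step {Γ : Type*} {M : DTM Γ} {w : List Γ} {c : M.Cfg} {n : ℕ} {P : Prop}
    (h : M.HaltsIn w (M.step w c) n P) : M.HaltsIn w c (n + 1) P := by
  simpa only [DTM.HaltsIn, Function.iterate_succ_apply] using h

theorem DTM.HaltsIn.congr {Γ : Type*} {M : DTM Γ} {w : List Γ} {c : M.Cfg} {n : ℕ} {P P' : Prop}
    (h : M.HaltsIn w c n P) (hP : P ↔ P') : M.HaltsIn w c n P' := by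
  obtain ⟨b, hb, h⟩ := h
  exact ⟨b, hb, h.trans hP⟩

theorem DTM.haltsIn_of_verdict {Γ : Type*} {M : DTM Γ} {w : List Γ} {c : M.Cfg} {b : Bool}
    (h : M.verdict c.state = some b) (n : ℕ) : M.HaltsIn w c n (b = true) := by
  have hs : M.step w c = c := by simp [DTM.step, h]
  exact ⟨b, by rw [Function.iterate_fixed hs, h], Iff.rfl⟩

theorem DTM.inputCell_of_drop_eq {Γ : Type*} {w rest : List Γ} {z : ℤ} (hz : 0 ≤ z)
    (h : w.drop z.toNat = rest) : DTM.inputCell w z = rest.head? := by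
  rw [DTM.inputCell, if_pos hz, ← h, List.head?_drop]

/-- The tape `T` carries the stack `st`, with its top in cell `h` and blanks below it. -/
def TapeStack (T : ℤ → Option Bool) (h : ℤ) (st : List Bool) : Prop :=
  ∀ i : ℕ, T (h - i) = st[i]?

theorem TapeStack.top {T : ℤ → Option Bool} {h : ℤ} {st : List Bool} (hT : TapeStack T h st) :
    T h = st.head? := by
  have := hT 0
  rw [List.head?_eq_getElem?]
  simpa using this

theorem TapeStack.pop {T : ℤ → Option Bool} {h : ℤ} {b : Bool} {st : List Bool}
    (hT : TapeStack T h (b :: st)) : TapeStack T (h - 1) st := fun i => by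
  have := hT (i + 1)
  rw [List.getElem?_cons_succ] at this
  rw [← this]
  congr 1
  push_cast
  ring

theorem TapeStack.push {T : ℤ → Option Bool} {h : ℤ} {st : List Bool}
    (hT : TapeStack T (h - 1) st) (b : Bool) :
    TapeStack (Function.update T h (some b)) h (b :: st) := fun i => by
  cases i with
  | zero => simp
  | succ i =>
    rw [List.getElem?_cons_succ, ← hT i, Function.update_of_ne (by push_cast; omega)]
    congr 1
    push_cast
    ring

variable {θ : Bool → Q → List Q} {q₀ : Q} {out : Q → L} {w rest : List (Option Bool ⊕ L)}

/-- The remaining input, after the part with the bits of `v`. -/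
def queryTail (out : Q → L) (u : List Bool) (q : Q) : List (Option Bool ⊕ L) :=
  u.map (fun b => .inl (some b)) ++ [.inl none, .inr (out q)]

theorem queryTail_cons (c : Bool) (u : List Bool) (q : Q) :
    queryTail out (c :: u) q = .inl (some c) :: queryTail out u q := rfl

theorem exists_queryTail_cons_iff {c : Bool} {P : List Bool → Q → Prop} :
    (∃ u q, .inl (some c) :: rest = queryTail out u q ∧ P u q) ↔
      ∃ u q, rest = queryTail out u q ∧ P (c :: u) q := by
  constructor
  · rintro ⟨u, q, h, hP⟩
    cases u with
    | nil => simp [queryTail] at h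
    | cons b u =>
      rw [queryTail_cons, List.cons.injEq, Sum.inl.injEq, Option.some.injEq] at h
      obtain ⟨rfl, h⟩ := h
      exact ⟨u, q, h, hP⟩
  · rintro ⟨u, q, h, hP⟩
    exact ⟨c :: u, q, by rw [h, queryTail_cons], hP⟩

variable [Finite Q]

/-- The position of the work head. -/
def scanHead (c : (scanMachine N θ q₀ out).Cfg) : ℤ := c.workHead (0 : Fin 1)

/-- The content of the work tape. -/
def scanTape (c : (scanMachine N θ q₀ out).Cfg) : ℤ → Option Bool := c.workTape (0 : Fin 1)

/-- In the configuration `c` the state is `s`, the part `rest` of the input `w` remains to be read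
and the work tape carries the stack `st`, with its top in the cell `o` below the head. -/
structure ScanConfig (w : List (Option Bool ⊕ L)) (c : (scanMachine N θ q₀ out).Cfg)
    (s : ScanState Q N) (rest : List (Option Bool ⊕ L)) (o : ℤ) (st : List Bool) : Prop where
  state_eq : c.state = s
  nonneg : 0 ≤ c.inputHead
  drop_eq : w.drop c.inputHead.toNat = rest
  stack : TapeStack (scanTape c) (scanHead c - o) st

theorem scanMachine_step {c : (scanMachine N θ q₀ out).Cfg} {s s' : ScanState Q N}
    {o : ℤ} {st : List Bool} (hc : ScanConfig w c s rest o st)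
    (hs : ∀ b, s ≠ .halt b) {t : Option Bool} {m : SignType}
    (hn : scanNext θ q₀ out s rest.head? (scanTape c (scanHead c)) = (s', t, m)) :
    let c' := (scanMachine N θ q₀ out).step w c
    c'.state = s' ∧ 0 ≤ c'.inputHead ∧ w.drop c'.inputHead.toNat = rest.tail ∧
      scanHead c' = scanHead c + (m : ℤ) ∧
      scanTape c' = Function.update (scanTape c) (scanHead c) t := by
  have hv : ((scanMachine N θ q₀ out).verdict c.state).isSome = false := by
    rw [hc.state_eq]
    cases s <;> first | rfl | exact absurd rfl (hs _)
  have hx := DTM.inputCell_of_drop_eq hc.nonneg hc.drop_eq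
  have h0 := hc.nonneg
  have ha : scanNext θ q₀ out c.state (DTM.inputCell w c.inputHead)
      (scanTape c (scanHead c)) = (s', t, m) := by rw [hx, hc.state_eq, hn]
  simp only [DTM.step, hv, Bool.false_eq_true, if_false]
  refine ⟨congrArg Prod.fst ha, ?_, ?_, ?_, ?_⟩
  · change 0 ≤ c.inputHead + ((1 : SignType) : ℤ)
    simp; omega
  · change w.drop (c.inputHead + ((1 : SignType) : ℤ)).toNat = _
    rw [← hc.drop_eq, List.tail_drop]
    congr 1
    simp; omega
  · exact congrArg (fun r => scanHead c + (r.2.2 : ℤ)) ha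
  · exact congrArg (fun r => Function.update (scanTape c) (scanHead c) r.2.1) ha

theorem haltsIn_of_next_halt {c : (scanMachine N θ q₀ out).Cfg} {s : ScanState Q N}
    {o : ℤ} {st : List Bool} (hc : ScanConfig w c s rest o st) (hs : ∀ b, s ≠ .halt b)
    {b : Bool} {t : Option Bool} {m : SignType}
    (hn : scanNext θ q₀ out s rest.head? (scanTape c (scanHead c)) = (.halt b, t, m))
    (n : ℕ) : (scanMachine N θ q₀ out).HaltsIn w c (n + 1) (b = true) := by
  refine DTM.HaltsIn.of_step (DTM.haltsIn_of_verdict ?_ n)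
  rw [(scanMachine_step hc hs hn).1]
  rfl

theorem haltsIn_finish {c : (scanMachine N θ q₀ out).Cfg} {ok : Bool} {o : ℤ} {st : List Bool}
    (hc : ScanConfig w c (.finish ok) rest o st) :
    (scanMachine N θ q₀ out).HaltsIn w c (rest.length + 1) (rest = [] ∧ ok = true) := by
  cases rest with
  | nil => exact (haltsIn_of_next_halt hc (by simp) rfl _).congr (by simp)
  | cons x rest => exact (haltsIn_of_next_halt (b := false) hc (by simp) rfl _).congr (by simp)

theorem haltsIn_letter {c : (scanMachine N θ q₀ out).Cfg} {q : Q} {st : List Bool}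
    (hc : ScanConfig w c (.letter q) rest 0 st) :
    (scanMachine N θ q₀ out).HaltsIn w c (rest.length + 1) (rest = [.inr (out q)]) := by
  classical
  match rest, hc with
  | [], hc => exact (haltsIn_of_next_halt (b := false) hc (by simp) rfl _).congr (by simp)
  | .inl x :: rest, hc =>
    exact (haltsIn_of_next_halt (b := false) hc (by simp) (by cases x <;> rfl) _).congr (by simp)
  | .inr a :: rest, hc =>
    obtain ⟨h1, h2, h3, h4, h5⟩ := scanMachine_step hc (by simp) rfl
    have hc' : ScanConfig w ((scanMachine N θ q₀ out).step w c) (.finish (decide (out q = a)))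
        rest 0 st := ⟨h1, h2, h3, by rw [h4, h5]; simpa using hc.stack⟩
    refine (haltsIn_finish hc').of_step.congr ?_
    simp [and_comm, eq_comm]

/-- Reading a bit matches one recursion step of `descend`. The acceptance condition therefore
concerns only the unread input, the current list and the stack, and the induction runs over the
unread input. -/
theorem haltsIn_scan (hθ : ∀ b q, (θ b q).length ≤ N)
    {c : (scanMachine N θ q₀ out).Cfg}
    {l : {l : List Q // l.length ≤ N}} {st : List Bool}
    (hc : ScanConfig w c (.scan l) rest 0 st) :
    (scanMachine N θ q₀ out).HaltsIn w c (rest.length + 1)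
      (∃ u q, rest = queryTail out u q ∧ descend θ u l.1 st = some q) := by
  induction rest generalizing c l st with
  | nil =>
    exact (haltsIn_of_next_halt (b := false) hc (by simp) rfl _).congr (by simp [queryTail])
  | cons x rest ih =>
    have ht : scanTape c (scanHead c) = st.head? := by simpa using hc.stack.top
    match x, hc with
    | .inr a, hc =>
      refine (haltsIn_of_next_halt (b := false) hc (by simp) rfl _).congr ?_
      simp only [Bool.false_eq_true, false_iff, not_exists]
      rintro u q ⟨h, -⟩
      cases u <;> simp [queryTail] at h
    | .inl none, hc =>
      have hiff : (∃ u q, .inl none :: rest = queryTail out u q ∧ descend θ u l.1 st = some q) ↔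
          ∃ q, rest = [.inr (out q)] ∧ st = [] ∧ single? l.1 = some q := by
        constructor
        · rintro ⟨u, q, h, hd⟩
          cases u with
          | nil =>
            rw [descend] at hd
            split_ifs at hd with hst
            exact ⟨q, by simpa [queryTail] using h, hst, hd⟩
          | cons b u => simp [queryTail] at h
        · rintro ⟨q, h, hst, hd⟩
          exact ⟨[], q, by simp [queryTail, h], by rw [descend, if_pos hst, hd]⟩
      cases st with
      | cons b st =>
        refine (haltsIn_of_next_halt (b := false) (t := some b) (m := 0) hc (by simp) ?_ _).congr ?_
        · rw [ht]; rfl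
        · rw [hiff]; simp
      | nil =>
        cases hl : single? l.1 with
        | none =>
          refine (haltsIn_of_next_halt (b := false) (t := none) (m := 0) hc (by simp) ?_ _).congr ?_
          · rw [ht]; simp [scanNext, hl]
          · rw [hiff]; simp [hl]
        | some q =>
          obtain ⟨h1, h2, h3, h4, h5⟩ := scanMachine_step (s' := .letter q) (t := none) (m := 0)
            hc (by simp) (by rw [ht]; simp [scanNext, hl])
          have hc' : ScanConfig w ((scanMachine N θ q₀ out).step w c) (.letter q)
              rest 0 [] := ⟨h1, h2, h3, by
            rw [h4, h5, Function.update_eq_self_iff.2 (by simpa using ht.symm)]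
            simpa using hc.stack⟩
          refine (haltsIn_letter hc').of_step.congr ?_
          rw [hiff]
          simp [hl]
    | .inl (some b), hc =>
      rw [exists_queryTail_cons_iff]
      cases hl : single? l.1 with
      | none =>
        obtain ⟨h1, h2, h3, h4, h5⟩ := scanMachine_step (s' := .scan (truncate N (halve b l.1)))
          (t := st.head?) (m := 0) hc (by simp) (by rw [ht]; simp [scanNext, hl])
        have hc' : ScanConfig w ((scanMachine N θ q₀ out).step w c)
            (.scan (truncate N (halve b l.1))) rest 0 st := ⟨h1, h2, h3, by
          rw [h4, h5, Function.update_eq_self_iff.2 (by simpa using ht.symm)]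
          simpa using hc.stack⟩
        refine (ih hc').of_step.congr ?_
        rw [truncate_val ((length_halve_le _ _).trans l.2)]
        simp only [descend, hl]
      | some q =>
        cases st with
        | nil =>
          refine (haltsIn_of_next_halt (b := false) (t := none) (m := 0) hc (by simp) ?_ _).congr ?_
          · rw [ht]; simp [scanNext, hl]
          · simp [descend, hl]
        | cons b' st =>
          -- Popping rewrites `b'` and moves left: cells above the head are not constrained by
          -- `TapeStack`, so nothing has to be erased.
          obtain ⟨h1, h2, h3, h4, h5⟩ := scanMachine_step
            (s' := .scan (truncate N (halve b (θ b' q)))) (t := some b') (m := -1) hc (by simp)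
            (by rw [ht]; simp [scanNext, hl])
          have hc' : ScanConfig w ((scanMachine N θ q₀ out).step w c)
              (.scan (truncate N (halve b (θ b' q)))) rest 0 st := ⟨h1, h2, h3, by
            rw [h4, h5, Function.update_eq_self_iff.2 (by simpa using ht.symm)]
            have := hc.stack
            rw [sub_zero] at this
            simpa [sub_eq_add_neg] using this.pop⟩
          refine (ih hc').of_step.congr ?_
          rw [truncate_val ((length_halve_le _ _).trans (hθ _ _))]
          simp only [descend, hl]

/-- The stack `st` holds the bits already read, last one on top; pushing the rest `v` gives
`v.reverse ++ st`. -/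
theorem haltsIn_push (hN : 1 ≤ N) (hθ : ∀ b q, (θ b q).length ≤ N)
    {c : (scanMachine N θ q₀ out).Cfg} {st : List Bool}
    (hc : ScanConfig w c .push rest 1 st) :
    (scanMachine N θ q₀ out).HaltsIn w c (rest.length + 1)
      (∃ (v u : List Bool) (q : Q),
        rest = v.map (fun b => .inl (some b)) ++ .inl none :: queryTail out u q ∧
        descend θ u [q₀] (v.reverse ++ st) = some q) := by
  induction rest generalizing c st with
  | nil =>
    exact (haltsIn_of_next_halt (b := false) hc (by simp) rfl _).congr (by simp)
  | cons x rest ih =>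
    match x, hc with
    | .inr a, hc =>
      refine (haltsIn_of_next_halt (b := false) hc (by simp) rfl _).congr ?_
      simp only [Bool.false_eq_true, false_iff, not_exists]
      rintro v u q ⟨h, -⟩
      cases v <;> simp at h
    | .inl none, hc =>
      -- At the separator the head steps back from the free cell to the top of the stack, which
      -- changes the offset from `1` to `0`.
      obtain ⟨h1, h2, h3, h4, h5⟩ := scanMachine_step (s' := .scan (truncate N [q₀]))
        (t := scanTape c (scanHead c)) (m := -1) hc (by simp) rfl
      have hc' : ScanConfig w ((scanMachine N θ q₀ out).step w c)
          (.scan (truncate N [q₀])) rest 0 st := ⟨h1, h2, h3, by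
        rw [h4, h5, Function.update_eq_self]
        simpa [sub_eq_add_neg] using hc.stack⟩
      refine (haltsIn_scan hθ hc').of_step.congr ?_
      rw [truncate_val (by simpa using hN)]
      constructor
      · rintro ⟨u, q, h, hd⟩
        exact ⟨[], u, q, by rw [h]; rfl, hd⟩
      · rintro ⟨v, u, q, h, hd⟩
        cases v with
        | nil => exact ⟨u, q, by simpa using h, hd⟩
        | cons b v => simp at h
    | .inl (some b), hc =>
      obtain ⟨h1, h2, h3, h4, h5⟩ := scanMachine_step (s' := .push)
        (t := some b) (m := 1) hc (by simp) rfl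
      have hc' : ScanConfig w ((scanMachine N θ q₀ out).step w c) .push rest 1 (b :: st) :=
        ⟨h1, h2, h3, by
          rw [h4, h5]
          simpa using hc.stack.push b⟩
      refine (ih hc').of_step.congr ?_
      constructor
      · rintro ⟨v, u, q, h, hd⟩
        exact ⟨b :: v, u, q, by rw [h]; rfl, by simpa using hd⟩
      · rintro ⟨v, u, q, h, hd⟩
        cases v with
        | nil => simp at h
        | cons b' v =>
          simp only [List.map_cons, List.cons_append, List.cons.injEq, Sum.inl.injEq,
            Option.some.injEq] at h
          obtain ⟨rfl, h⟩ := h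
          exact ⟨v, u, q, h, by simpa using hd⟩

/-- One step per input symbol, and one more to see the blank after the last symbol. -/
theorem scanMachine_decidesInTime (hN : 1 ≤ N) (hθ : ∀ b q, (θ b q).length ≤ N) :
    (scanMachine N θ q₀ out).DecidesInTime
      {w | ∃ (v u : List Bool) (q : Q),
        w = v.map (fun b => .inl (some b)) ++ .inl none :: queryTail out u q ∧
        descend θ u [q₀] v.reverse = some q} (fun n => 1 * n + 1) := fun w => by
  have hc : ScanConfig w (scanMachine N θ q₀ out).init .push w 1 [] :=
    ⟨rfl, le_rfl, rfl, fun i => rfl⟩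
  have h := haltsIn_push hN hθ hc
  simpa [DTM.HaltsIn] using h

end Machine

/-! ### Evaluation of words and commutator trees -/

section Words

variable {S : Type} {H : Type*} [Group H] (φ : FreeGroup S →* H)

theorem wordEval_append (u v : List (StdLetter S)) :
    wordEval φ (u ++ v) = wordEval φ u * wordEval φ v := by
  simp [wordEval]

theorem letterEval_inv (a : StdLetter S) : letterEval φ a.inv = (letterEval φ a)⁻¹ := by
  rcases a with _ | ⟨s, b⟩
  · simp [letterEval, StdLetter.inv]
  · cases b <;> simp [letterEval, StdLetter.inv]

theorem wordEval_wordInv (u : List (StdLetter S)) : wordEval φ (wordInv u) = (wordEval φ u)⁻¹ := by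
  simp [wordEval, wordInv, List.prod_inv_reverse, Function.comp_def, letterEval_inv]

theorem wordEval_wordComm (u v : List (StdLetter S)) :
    wordEval φ (wordComm u v) =
      (wordEval φ u)⁻¹ * (wordEval φ v)⁻¹ * wordEval φ u * wordEval φ v := by
  simp only [wordComm, wordEval_append, wordEval_wordInv]

theorem exists_wordEval_eq {φ : FreeGroup S →* H} (hφ : Function.Surjective φ) (y : H) :
    ∃ u : List (StdLetter S), wordEval φ u = y := by
  obtain ⟨z, rfl⟩ := hφ y
  induction z using FreeGroup.induction_on with
  | C1 => exact ⟨[], by simp [wordEval]⟩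
  | of s => exact ⟨[some (s, true)], by simp [wordEval, letterEval]⟩
  | inv_of s _ => exact ⟨[some (s, false)], by simp [wordEval, letterEval]⟩
  | mul a b ha hb =>
    obtain ⟨u, hu⟩ := ha
    obtain ⟨v, hv⟩ := hb
    exact ⟨u ++ v, by rw [wordEval_append, hu, hv, map_mul]⟩

/-- The commutator of depth `n` at the vertex `v` of the binary tree, for given leaves. -/
def commTree (leaf : List Bool → List (StdLetter S)) : ℕ → List Bool → List (StdLetter S)
  | 0, v => leaf v
  | n + 1, v => wordComm (commTree leaf n (v ++ [false])) (commTree leaf n (v ++ [true]))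

/-- Leaves are expanded along `v.reverse` because the stack returns the last bit of `v` first. -/
theorem isUniformlySENSOver_of_expand [Finite S] {φ : FreeGroup S →* H} {Q : Type} [Finite Q]
    {θ : Bool → Q → List Q} {q₀ : Q} {out : Q → StdLetter S} {μ : ℕ} (hμ : 0 < μ)
    (hθ : ∀ b q, (θ b q).length = 2 ^ μ)
    (hne : ∀ d, wordEval φ (commTree (fun v => (expand θ v.reverse q₀).map out) d []) ≠ 1) :
    IsUniformlySENSOver φ := by
  refine ⟨μ, fun d v => commTree (fun v => (expand θ v.reverse q₀).map out) (d - v.length) v,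
    ⟨fun d v hv => ?_, fun d v hv => ?_, fun d => by simpa using hne d⟩,
    scanMachine (2 ^ μ) θ q₀ out, 1, ?_⟩
  · simp [hv, commTree, length_expand hθ]
  · obtain ⟨n, rfl⟩ := Nat.exists_eq_add_of_lt hv
    simp only [List.length_append, List.length_singleton]
    rw [show v.length + n + 1 - v.length = n + 1 by omega,
      show v.length + n + 1 - (v.length + 1) = n by omega]
    rfl
  · convert scanMachine_decidesInTime (q₀ := q₀) (out := out) (Nat.one_le_two_pow (n := μ))
      (fun b q => (hθ b q).le) using 1
    ext w
    -- Queries concern leaves only, where the remaining depth is `0`.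
    simp only [letterLanguage, Set.mem_ofPred_eq, Nat.sub_self, commTree]
    constructor
    · rintro ⟨v, i, a, hi, ha, rfl⟩
      rw [List.getElem?_map, Option.map_eq_some_iff] at ha
      obtain ⟨q, hq, rfl⟩ := ha
      refine ⟨v, binaryBits (μ * v.length) i, q, by simp [encodeQuery, queryTail], ?_⟩
      rw [descend_eq hμ hθ _ _ _ 0 rfl (by simp [length_binaryBits]), bitsValue_binaryBits hi]
      simpa using hq
    · rintro ⟨v, u, q, rfl, hq⟩
      have hu : u.length = μ * v.length := by
        simpa using length_of_descend_eq_some hμ hθ u _ _ 0 rfl hq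
      rw [descend_eq hμ hθ _ _ _ 0 rfl (by simp [hu])] at hq
      refine ⟨v, bitsValue u, out q, hu ▸ bitsValue_lt u, ?_, ?_⟩
      · rw [List.getElem?_map, Option.map_eq_some_iff]
        exact ⟨q, by simpa using hq, rfl⟩
      · rw [← hu, binaryBits_bitsValue]
        simp [encodeQuery, queryTail]

theorem List.prod_map_flatMap {α β M : Type*} [Monoid M] (l : List α) (f : α → List β)
    (g : β → M) : ((l.flatMap f).map g).prod = (l.map fun x => ((f x).map g).prod).prod := by
  induction l with
  | nil => simp
  | cons x l ih => simp [ih]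

end Words

/-! ### The commutators in a branching subgroup -/

section Placement

variable {X : Type*} {K : Subgroup (treeAut X)}

/-- The automorphism `x` fixes the vertex `p`, and its state there is `y`. -/
def ActsBelow (p : List X) (x y : K) : Prop := ∀ w, x.1.1 (p ++ w) = p ++ y.1.1 w

theorem ActsBelow.mul {p : List X} {x y x' y' : K} (h : ActsBelow p x y)
    (h' : ActsBelow p x' y') : ActsBelow p (x * x') (y * y') := fun w => by
  change x.1.1 (x'.1.1 (p ++ w)) = p ++ y.1.1 (y'.1.1 w)
  rw [h' w, h]

theorem ActsBelow.inv {p : List X} {x y : K} (h : ActsBelow p x y) :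
    ActsBelow p x⁻¹ y⁻¹ := fun w => by
  change x.1.1.symm (p ++ w) = p ++ y.1.1.symm w
  rw [Equiv.symm_apply_eq, h, Equiv.apply_symm_apply]

/-- The iterate of `ψ`, as often as there are letters `true` at the beginning of a word. -/
def leadIterate (ψ : K →* K) : List Bool → K →* K
  | true :: v => ψ.comp (leadIterate ψ v)
  | _ => MonoidHom.id K

theorem leadIterate_apply_comm (ψ : K →* K) (v : List Bool) (h : K) :
    leadIterate ψ v (ψ h) = ψ (leadIterate ψ v h) := by
  induction v with
  | nil => rfl
  | cons b v ih =>
    cases b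
    · rfl
    · exact congrArg ψ ih

/-- Appending `false` to `v` resets the number of trailing `true`s to zero, appending `true` raises
it by one, so the children act as `k` and `ψ h` when the parent should act as `h`. Elsewhere in the
tree the action is irrelevant. The leaf at `[]` is excluded, since a single letter need not spell
`k`. -/
theorem exists_commTree_actsBelow {S : Type} {H : Type*} [Group H] {φ : FreeGroup S →* H}
    {ι : K →* H} {u : List X} {ψ : K →* K} (hψ : IsPlacement u ψ) {k : K} (hk : k.1.1 u ≠ u)
    {leaf : List Bool → List (StdLetter S)}
    (hleaf : ∀ v, v ≠ [] → wordEval φ (leaf v) = ι (leadIterate ψ v.reverse k)) (n : ℕ)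
    (v : List Bool) (hv : n ≠ 0 ∨ v ≠ []) :
    ∃ x : K, wordEval φ (commTree leaf n v) = ι x ∧
      ActsBelow (List.replicate n u).flatten x (leadIterate ψ v.reverse k) := by
  induction n generalizing v with
  | zero =>
    exact ⟨_, hleaf v (by simpa using hv), fun w => rfl⟩
  | succ n ih =>
    obtain ⟨x₀, he₀, h₀⟩ := ih (v ++ [false]) (by simp)
    obtain ⟨x₁, he₁, h₁⟩ := ih (v ++ [true]) (by simp)
    rw [List.reverse_append] at h₀ h₁
    have hc := ((h₀.inv.mul h₁.inv).mul h₀).mul h₁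
    refine ⟨x₀⁻¹ * x₁⁻¹ * x₀ * x₁, ?_, fun w => ?_⟩
    · rw [commTree, wordEval_wordComm, he₀, he₁]
      simp only [map_mul, map_inv]
    -- Split off the last copy of `u`: the commutator is computed below `u^n` and then evaluated
    -- below `u`.
    · rw [List.replicate_succ', List.flatten_append, List.flatten_singleton, List.append_assoc,
        hc (u ++ w), List.append_assoc]
      exact congrArg _ (hψ.commutator_apply hk _ w)

/-! ### Spelling the leaves by substitutions -/

/-- Data for spelling the leaves: a symbol `inl (a, s)` stands for `val a` and is printed as `s`,
a symbol `inr s` is final.  The substitution `true` applies `ψ` to the values, the substitution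
`false` spells them out. -/
structure IsSpelling {S : Type} {H : Type*} [Group H] (φ : FreeGroup S →* H) (ι : K →* H)
    (ψ : K →* K) {A : Type} (val : A → K) (μ : ℕ)
    (θ : Bool → (A × StdLetter S) ⊕ StdLetter S → List ((A × StdLetter S) ⊕ StdLetter S)) :
    Prop where
  length_eq : ∀ b q, (θ b q).length = 2 ^ μ
  final : ∀ b s, ∃ n, θ b (.inr s) = .inr s :: List.replicate n (.inr none)
  spell : ∀ a s, ∃ l : List (StdLetter S), θ false (.inl (a, s)) = l.map .inr ∧
    wordEval φ l = ι (val a)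
  apply : ∀ a s, ∃ l : List (A × StdLetter S), θ true (.inl (a, s)) = l.map .inl ∧
    (l.map fun p => val p.1).prod = ψ (val a) ∧ wordEval φ (l.map Prod.snd) = ι (ψ (val a))

section

variable {S : Type} {H : Type*} [Group H] {φ : FreeGroup S →* H} {ι : K →* H} {ψ : K →* K}
  {A : Type} {val : A → K} {μ : ℕ}
  {θ : Bool → (A × StdLetter S) ⊕ StdLetter S → List ((A × StdLetter S) ⊕ StdLetter S)}

theorem wordEval_expand_cons {Q : Type} {θ : Bool → Q → List Q} {out : Q → StdLetter S}
    (b : Bool) (v : List Bool) (q : Q) :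
    wordEval φ ((expand θ (b :: v) q).map out) =
      ((θ b q).map fun q => wordEval φ ((expand θ v q).map out)).prod := by
  simp only [wordEval, expand, List.map_map, List.prod_map_flatMap]

theorem IsSpelling.wordEval_final (hθ : IsSpelling φ ι ψ val μ θ) (v : List Bool)
    (s : StdLetter S) :
    wordEval φ ((expand θ v (.inr s)).map (Sum.elim Prod.snd id)) = letterEval φ s := by
  induction v generalizing s with
  | nil => simp [expand, wordEval]
  | cons b v ih =>
    obtain ⟨n, hn⟩ := hθ.final b s
    rw [wordEval_expand_cons, hn]
    simp [ih, letterEval]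

/-- At least one substitution is required, because the letter printed by the initial symbol is
arbitrary. -/
theorem IsSpelling.wordEval_live (hθ : IsSpelling φ ι ψ val μ θ) (v : List Bool) (hv : v ≠ [])
    (a : A) (s : StdLetter S) :
    wordEval φ ((expand θ v (.inl (a, s))).map (Sum.elim Prod.snd id)) =
      ι (leadIterate ψ v (val a)) := by
  induction v generalizing a s with
  | nil => exact absurd rfl hv
  | cons b v ih =>
    rw [wordEval_expand_cons]
    cases b with
    | false =>
      obtain ⟨l, hl, he⟩ := hθ.spell a s
      rw [hl, List.map_map]
      simp only [Function.comp_def, hθ.wordEval_final]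
      exact he
    | true =>
      obtain ⟨l, hl, hp, he⟩ := hθ.apply a s
      rw [hl, List.map_map]
      by_cases hv' : v = []
      -- No substitution remains, so the symbols are printed while still live; their second
      -- components must already spell the value.
      · subst hv'
        rw [wordEval, List.map_map] at he
        simpa [expand, wordEval, Function.comp_def, leadIterate] using he
      · simp only [Function.comp_def, ih hv']
        change _ = ι (ψ (leadIterate ψ v (val a)))
        rw [← leadIterate_apply_comm, ← hp, map_list_prod, map_list_prod, List.map_map,
          List.map_map]
        rfl

end

/-- `S` generates `H` and not `K`, so each word of live symbols carries two readings: a product of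
generators of `K` and a printed word over `S`. -/
theorem exists_isSpelling {S : Type} {H : Type*} [Group H] {φ : FreeGroup S →* H}
    (hφ : Function.Surjective φ) (ι : K →* H) (ψ : K →* K) {A : Type} [Finite A] {val : A → K}
    {e : A} (he : val e = 1) (hval : ∀ h : K, ∃ l : List A, (l.map val).prod = h) :
    ∃ μ θ, 0 < μ ∧ IsSpelling φ ι ψ val μ θ := by
  choose spell hspell using exists_wordEval_eq hφ
  choose factor hfactor using hval
  -- The first symbol carries the value and prints `1`; the others have value `1` and print the
  -- spelling.
  let block : A → List (A × StdLetter S) := fun a =>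
    (a, none) :: (spell (ι (val a))).map fun s => (e, s)
  let live : A → List (A × StdLetter S) := fun a => (factor (ψ (val a))).flatMap block
  -- `N` bounds both kinds of words; the exponent `N + 1` leaves room for padding and is positive.
  obtain ⟨N, hN⟩ := (Set.finite_range fun a =>
    (live a).length + (spell (ι (val a))).length).bddAbove
  have hlt : ∀ a, (live a).length + (spell (ι (val a))).length ≤ 2 ^ (N + 1) := fun a =>
    (hN ⟨a, rfl⟩).trans (N.le_succ.trans Nat.lt_two_pow_self.le)
  have hblock₁ : ∀ a, ((block a).map fun p => val p.1).prod = val a := fun a => by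
    simp [block, Function.comp_def, he]
  have hblock₂ : ∀ a, ((block a).map fun p => letterEval φ p.2).prod = ι (val a) := fun a => by
    have h1 : letterEval φ none = 1 := rfl
    have h2 := hspell (ι (val a))
    rw [wordEval] at h2
    simpa [block, Function.comp_def, h1] using h2
  refine ⟨N + 1, fun b q => match b, q with
    | true, .inl (a, _) =>
      (live a ++ List.replicate (2 ^ (N + 1) - (live a).length) (e, none)).map .inl
    | false, .inl (a, _) =>
      (spell (ι (val a)) ++
        List.replicate (2 ^ (N + 1) - (spell (ι (val a))).length) none).map .inr
    | _, .inr s => .inr s :: List.replicate (2 ^ (N + 1) - 1) (.inr none),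
    N.succ_pos, ⟨?_, ?_, ?_, ?_⟩⟩
  · rintro b (⟨a, s⟩ | s)
    · have := hlt a
      cases b <;> simp <;> omega
    · have := Nat.one_le_two_pow (n := N + 1)
      cases b <;> simp <;> omega
  · intro b s
    cases b <;> exact ⟨_, rfl⟩
  · intro a s
    refine ⟨_, rfl, ?_⟩
    rw [wordEval_append, hspell]
    simp [wordEval, letterEval]
  · intro a s
    refine ⟨_, rfl, ?_, ?_⟩
    · simp only [List.map_append, List.prod_append, live, List.prod_map_flatMap, hblock₁]
      simp [hfactor, he]
    · rw [wordEval, List.map_map]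
      simp only [List.map_append, List.prod_append, live, Function.comp_def,
        List.prod_map_flatMap, hblock₂]
      have := congrArg ι (hfactor (ψ (val a)))
      rw [map_list_prod, List.map_map] at this
      simpa [letterEval, Function.comp_def] using this

/-- Substitutions produce positive words, so monoid generators are needed; `1` serves as padding and
`k` as the initial symbol. -/
theorem exists_finite_generators {M : Type*} [Group M] (hM : Group.FG M) (k : M) :
    ∃ (n : ℕ) (val : Fin n → M) (e a : Fin n), val e = 1 ∧ val a = k ∧
      ∀ h : M, ∃ l : List (Fin n), (l.map val).prod = h := by
  obtain ⟨T, hT, hfin⟩ := Monoid.fg_iff.1 (Group.fg_iff_monoid_fg.1 hM)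
  obtain ⟨n, val, -, hr⟩ := ((hfin.insert k).insert 1).fin_param
  have hmem : ∀ x ∈ insert 1 (insert k T), ∃ a, val a = x := fun x hx => by rwa [← hr] at hx
  obtain ⟨e, he⟩ := hmem 1 (by simp)
  obtain ⟨a, ha⟩ := hmem k (by simp)
  refine ⟨n, val, e, a, he, ha, fun h => ?_⟩
  have hh : h ∈ Submonoid.closure T := hT ▸ Submonoid.mem_top h
  induction hh using Submonoid.closure_induction with
  | mem x hx =>
    obtain ⟨b, rfl⟩ := hmem x (by simp [hx])
    exact ⟨[b], by simp⟩
  | one => exact ⟨[], rfl⟩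
  | mul x y _ _ hx hy =>
    obtain ⟨l, rfl⟩ := hx
    obtain ⟨l', rfl⟩ := hy
    exact ⟨l ++ l', by simp⟩

/-- A group that contains a finitely generated branching subgroup is uniformly strongly
efficiently non-solvable with respect to each of its finite generating sets. -/
theorem isUniformlySENSOver_of_injective {G : Subgroup (treeAut X)}
    (hK : IsBranchingSubgroup K G) (hfg : Group.FG K) {H : Type*} [Group H] {ι : K →* H}
    (hι : Function.Injective ι) {S : Type} [Finite S] {φ : FreeGroup S →* H}
    (hφ : Function.Surjective φ) : IsUniformlySENSOver φ := by
  obtain ⟨g, hgK, hg⟩ := K.bot_or_exists_ne_one.resolve_left hK.2.1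
  obtain ⟨u, hu⟩ : ∃ u, g.1 u ≠ u := by
    by_contra! h
    exact hg (Subtype.ext (Equiv.ext h))
  obtain ⟨ψ, hψ⟩ := exists_isPlacement hK u
  obtain ⟨n, val, e, a, he, ha, hval⟩ := exists_finite_generators hfg ⟨g, hgK⟩
  obtain ⟨μ, θ, hμ, hθ⟩ := exists_isSpelling hφ ι ψ he hval
  -- For `d = 0` the word is the single letter printed by the initial symbol, which must be
  -- non-trivial.
  obtain ⟨s, hs⟩ : ∃ s : StdLetter S, letterEval φ s ≠ 1 := by
    by_contra! h
    obtain ⟨w, hw⟩ := exists_wordEval_eq hφ (ι ⟨g, hgK⟩)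
    rw [wordEval, List.prod_eq_one (by simp [h]), eq_comm, map_eq_one_iff ι hι] at hw
    exact hg (congrArg Subtype.val hw)
  refine isUniformlySENSOver_of_expand (q₀ := .inl (a, s)) (out := Sum.elim Prod.snd id) hμ
    hθ.length_eq fun d => ?_
  cases d with
  | zero => simpa [commTree, expand, wordEval] using hs
  | succ d =>
    obtain ⟨x, hx, hact⟩ := exists_commTree_actsBelow (φ := φ) (ι := ι) hψ (k := ⟨g, hgK⟩) hu
      (leaf := fun v => (expand θ v.reverse (.inl (a, s))).map (Sum.elim Prod.snd id))
      (fun v hv => by rw [hθ.wordEval_live _ (by simpa using hv), ha]) (d + 1) [] (by simp)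
    rw [hx, Ne, map_eq_one_iff ι hι]
    rintro rfl
    exact hu (List.append_cancel_left (hact u)).symm

end Placement

theorem mainTheorem11 {X : Type*} [Finite X] (G K : Subgroup (treeAut X))
    (hG : IsWeaklyBranched G) (hK : IsBranchingSubgroup K G) (hfg : K.FG) :
    IsUniformlySENS K ∧ (Group.FG G → IsUniformlySENS G) := by
  have hfg' : Group.FG K := (Group.fg_iff_subgroup_fg K).2 hfg
  exact ⟨⟨hfg', fun S _ φ hφ =>
      isUniformlySENSOver_of_injective hK hfg' (ι := MonoidHom.id K) Function.injective_id hφ⟩,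
    fun hGfg => ⟨hGfg, fun S _ φ hφ => isUniformlySENSOver_of_injective hK hfg'
      (Subgroup.inclusion_injective hK.1) hφ⟩⟩
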